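/- Let $*:\widehat S\to\widehat{{}^*S}$ be a nonstandard embedding, i.e. a map from the superstructure $\widehat S$ over a base set $S$ (containing a copy of $\mathbb N$) to the superstructure over ${}^*S$ that satisfies the Transfer Principle for bounded formulas; a set is internal if it is an element of ${}^*X$ for some $X\in\widehat S$. Let $B$ be an internal Dedekind ring with internal quotient field $L$: $B$ is an internal integral domain (underlying set and operations are internal); it is $*$-integrally closed, i.e. every $x\in L$ that is a zero of a monic polynomial $\sum_{i=0}^N a_ix^i$ of hyperfinite degree $N\in{}^*\mathbb N$ with an internal sequence of coefficients $a_i\in B$ lies in $B$; and every nonzero internal prime ideal of $B$ is maximal. Then every nonzero prime ideal of $B$, internal or not, is contained in exactly one maximal ideal of $B$ (internal or not). In particular, let $U$ be an ultrafilter on a set $I$, let $(A_i)_{i\in I}$ be Dedekind domains, and let $B=\left(\prod_{i\in I}A_i\right)/U$ be their ultraproduct (two families are identified if they agree on a set belonging to $U$); for example $B={}^*\mathcal O_K$, the ultrapower of the ring of integers of a number field $K$. Then every nonzero prime ideal of $B$ is contained in exactly one maximal ideal of $B$. -/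

import Mathlib

universe u

namespace Nonstandard

/-! ## Superstructures

Sets are elements of `ZFSet`. The elements of a base set are treated as atoms. -/

/-- The levels `V₀ = S`, `Vₙ₊₁ = Vₙ ∪ 𝒫(Vₙ)` of the superstructure over `S`. -/
def level (S : ZFSet.{u}) : ℕ → ZFSet.{u}
  | 0 => S
  | n + 1 => level S n ∪ (level S n).powerset

/-- The superstructure `Ŝ = ⋃ₙ Vₙ` over `S`. -/
def superstructure (S : ZFSet.{u}) : Set ZFSet.{u} := {x | ∃ n, x ∈ level S n}

/-- `S` is a base set: its elements behave as atoms inside the superstructure over `S`, that is,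
each of them is nonempty but has no element in common with the superstructure. -/
def IsBaseSet (S : ZFSet.{u}) : Prop :=
  ∀ s ∈ S, s ≠ ∅ ∧ ∀ x ∈ s, x ∉ superstructure S

/-! ## Bounded formulas and transfer -/

/-- Formulas of the language of set theory in the variables `v 0, v 1, …` all of whose quantifiers
are bounded; the other connectives and the bounded existential quantifier are definable.
`all k i φ` is `∀ v k ∈ v i, φ`. -/
inductive BoundedFormula : Type
  | eq (i j : ℕ) : BoundedFormula
  | mem (i j : ℕ) : BoundedFormula
  | not (φ : BoundedFormula) : BoundedFormula
  | and (φ ψ : BoundedFormula) : BoundedFormula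
  | all (k i : ℕ) (φ : BoundedFormula) : BoundedFormula

/-- Truth of a bounded formula in the superstructure over `S`, under an assignment `v`. -/
def BoundedFormula.Realize (S : ZFSet.{u}) : BoundedFormula → (ℕ → ZFSet.{u}) → Prop
  | .eq i j, v => v i = v j
  | .mem i j, v => v i ∈ v j
  | .not φ, v => ¬ φ.Realize S v
  | .and φ ψ, v => φ.Realize S v ∧ ψ.Realize S v
  | .all k i φ, v => ∀ x ∈ superstructure S, x ∈ v i → φ.Realize S (Function.update v k x)

end Nonstandard

open Nonstandard in
/-- A nonstandard embedding `* : Ŝ → (*S)^` between superstructures: a map which sends the base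
set `S` to the base set `*S` and satisfies the Transfer Principle. The natural numbers are
identified with certain elements of `S`. -/
structure NonstandardEmbedding where
  /-- the base set -/
  base : ZFSet.{u}
  isBaseSet : IsBaseSet base
  /-- the map `*`; only its values on the superstructure over `base` matter -/
  star : ZFSet.{u} → ZFSet.{u}
  isBaseSet_star : IsBaseSet (star base)
  star_mem : ∀ x ∈ superstructure base, star x ∈ superstructure (star base)
  transfer : ∀ (φ : BoundedFormula) (v : ℕ → ZFSet.{u}), (∀ k, v k ∈ superstructure base) →
    (φ.Realize base v ↔ φ.Realize (star base) (fun k => star (v k)))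
  /-- the copy of `ℕ` inside the base set -/
  num : ℕ → ZFSet.{u}
  num_injective : Function.Injective num
  num_mem : ∀ n, num n ∈ base

namespace Nonstandard

/-! ## Graphs of functions as sets -/

/-- The set of those elements of `B` that lie in `s`. -/
def ofSubset (B : ZFSet.{u}) (s : Set B) : ZFSet.{u} :=
  B.sep (fun x => ∃ h : x ∈ B, (⟨x, h⟩ : B) ∈ s)

/-- The graph of a function, as a set of ordered pairs. -/
def graph {B C : ZFSet.{u}} (f : B → C) : ZFSet.{u} :=
  (ZFSet.prod B C).sep (fun t => ∃ x : B, t = ZFSet.pair x (f x))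

/-- The graph of a binary operation, as a set of pairs `((x, y), f x y)`. -/
def graph₂ {B : ZFSet.{u}} (f : B → B → B) : ZFSet.{u} :=
  (ZFSet.prod (ZFSet.prod B B) B).sep
    (fun t => ∃ x y : B, t = ZFSet.pair (ZFSet.pair x y) (f x y))

end Nonstandard

namespace NonstandardEmbedding

open Nonstandard

variable (E : NonstandardEmbedding.{u})

/-- Internal sets: the elements of sets `*X` with `X ∈ Ŝ` which are not atoms of `(*S)^`. -/
def IsInternal (y : ZFSet.{u}) : Prop :=
  y ∈ superstructure (E.star E.base) ∧ y ∉ E.star E.base ∧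
    ∃ X ∈ superstructure E.base, y ∈ E.star X

/-- The copy of `ℕ` in the base set, as a set. -/
def natSet : ZFSet.{u} := E.base.sep (fun x => ∃ n, x = E.num n)

/-- The graph of the successor function on the copy of `ℕ`. -/
def succSet : ZFSet.{u} :=
  (ZFSet.prod E.natSet E.natSet).sep
    (fun t => ∃ n, t = ZFSet.pair (E.num n) (E.num (n + 1)))

/-- The set `*ℕ` of hypernatural numbers. -/
def hyperNat : ZFSet.{u} := E.star E.natSet

/-- `i` is the zero of `*ℕ`. -/
def IsZero (i : E.hyperNat) : Prop := (i : ZFSet.{u}) = E.star (E.num 0)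

/-- `j = i + 1` in `*ℕ`. -/
def IsSucc (i j : E.hyperNat) : Prop := ZFSet.pair i j ∈ E.star E.succSet

/-- A commutative ring is internal if its underlying set and its operations are internal. -/
structure IsInternalRing (B : ZFSet.{u}) [CommRing B] : Prop where
  carrier : E.IsInternal B
  add : E.IsInternal (graph₂ (fun x y : B => x + y))
  mul : E.IsInternal (graph₂ (fun x y : B => x * y))

/-- `L`, with the given map `B → L`, is an internal quotient field of the internal ring `B`. -/
structure IsInternalFractionField (B L : ZFSet.{u}) [CommRing B] [Field L] [Algebra B L] :
    Prop where
  isInternalRing : E.IsInternalRing L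
  isFractionRing : IsFractionRing B L
  algebraMap : E.IsInternal (graph (algebraMap B L))

/-- `x ∈ L` is `*`-integral over `B`: it is a zero of a monic polynomial `∑_{i ≤ N} a i * x ^ i`
of hyperfinite degree `N ∈ *ℕ` with an internal sequence `a` of coefficients in `B`. Here
`pow i = x ^ i` and `sum i = ∑_{j ≤ i} a j * x ^ j` are the internal sequences in `L`
given by the usual recursions. -/
def IsStarIntegral (B L : ZFSet.{u}) [CommRing B] [Field L] [Algebra B L] (x : L) : Prop :=
  ∃ (N : E.hyperNat) (a : E.hyperNat → B) (pow sum : E.hyperNat → L),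
    E.IsInternal (graph a) ∧ E.IsInternal (graph pow) ∧ E.IsInternal (graph sum) ∧
    (∀ i, E.IsZero i → pow i = 1) ∧
    (∀ i j, E.IsSucc i j → pow j = pow i * x) ∧
    (∀ i, E.IsZero i → sum i = algebraMap B L (a i)) ∧
    (∀ i j, E.IsSucc i j → sum j = sum i + algebraMap B L (a j) * pow j) ∧
    a N = 1 ∧ sum N = 0

/-- `B`, with internal quotient field `L`, is an internal Dedekind ring: an internal domain which is
`*`-integrally closed and in which every nonzero internal prime ideal is maximal. (All elements of
`B` are `*`-integral, so that only one inclusion is demanded in `starIntegrallyClosed`.) -/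
structure IsInternalDedekindRing (B L : ZFSet.{u}) [CommRing B] [Field L] [Algebra B L] :
    Prop where
  isInternalRing : E.IsInternalRing B
  isDomain : IsDomain B
  isInternalFractionField : E.IsInternalFractionField B L
  starIntegrallyClosed : ∀ x : L, E.IsStarIntegral B L x → x ∈ Set.range (algebraMap B L)
  isMaximal_of_isPrime : ∀ p : Ideal B, E.IsInternal (ofSubset B (p : Set B)) → p ≠ ⊥ →
    p.IsPrime → p.IsMaximal

end NonstandardEmbedding

namespace Nonstandard

/-- The ideal of those families in `∏ i, A i` which vanish on a set of the ultrafilter `U`. -/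
def ultraIdeal {ι : Type*} (U : Ultrafilter ι) (A : ι → Type*) [∀ i, CommRing (A i)] :
    Ideal (∀ i, A i) where
  carrier := {x | ∀ᶠ i in (U : Filter ι), x i = 0}
  add_mem' := by
    intro x y hx hy
    filter_upwards [hx, hy] with i h1 h2
    simp [h1, h2]
  zero_mem' := by simp
  smul_mem' := by
    intro c x hx
    filter_upwards [hx] with i h
    simp [h]

/-- The ultraproduct `(∏ i, A i) / U` of rings. -/
abbrev Ultraproduct {ι : Type*} (U : Ultrafilter ι) (A : ι → Type*) [∀ i, CommRing (A i)] :=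
  (∀ i, A i) ⧸ ultraIdeal U A

end Nonstandard

namespace Nonstandard

/-! ## Splitting elements between comaximal elements -/

section Algebra

variable {R : Type*} [CommRing R]

/-! Suppose a prime `p ≠ 0` lies in two distinct maximal ideals `m`, `m'`. Choose `a ∈ m` and `b ∈
m'` with `a + b = 1`, and `x ≠ 0` in `p`. If some multiple of `x` factors as `u * v` with `u ≡ 1`
mod `a` and `v ≡ 1` mod `b`, then `p` contains `u` or `v`, so `1 ∈ m` or `1 ∈ m'`, which is absurd.
It is therefore enough to split every `x ≠ 0` in this way.

In any commutative ring, either `x` splits or some prime containing `x` avoids both classes `1 +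
(a)` and `1 + (b)` (`splits_or_exists_prime`). When `a + b = 1` such a prime is not maximal
(`not_isMaximal_of_forall_ne`), so splittings exist once nonzero primes are maximal.

For an ultraproduct the splittings are chosen componentwise. For an internal ring the dichotomy
itself is transferred: the prime it yields is internal, so the hypothesis on internal primes
excludes it. To this end the dichotomy is written as a bounded formula about graphs of operations,
with the prime ranging over a fixed level of the superstructure. -/

/-- A multiple of `x` is a product of two elements, the first of which is a unit modulo `a` and
the second of which is a unit modulo `b`. -/
def Splits (x a b : R) : Prop :=
  ∃ u v c r s, u * v = x * c ∧ u + a * r = 1 ∧ v + b * s = 1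

/-- The products of an element of `1 + (a)` and an element of `1 + (b)` form a multiplicative set,
and splitting means that `(x)` meets it. If it does not, a prime containing `x` and disjoint from
this set exists. -/
theorem splits_or_exists_prime (x a b : R) :
    Splits x a b ∨ ∃ P : Ideal R, P.IsPrime ∧ x ∈ P ∧
      (∀ u ∈ P, ∀ r, u + a * r ≠ 1) ∧ ∀ v ∈ P, ∀ s, v + b * s ≠ 1 := by
  by_contra! hcon
  obtain ⟨hx, hcon⟩ := hcon
  let S : Submonoid R :=
    { carrier := {w | ∃ u v r s, w = u * v ∧ u + a * r = 1 ∧ v + b * s = 1}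
      one_mem' := ⟨1, 1, 0, 0, by simp, by simp, by simp⟩
      mul_mem' := by
        rintro _ _ ⟨u, v, r, s, rfl, h1, h2⟩ ⟨u', v', r', s', rfl, h3, h4⟩
        refine ⟨u * u', v * v', r + u * r', s + v * s', by ring, ?_, ?_⟩
        · linear_combination h1 + u * h3
        · linear_combination h2 + v * h4 }
  obtain ⟨P, hP, hxP, hd⟩ := Ideal.exists_le_prime_disjoint (Ideal.span {x}) S (by
    refine Set.disjoint_left.2 ?_
    rintro w hw ⟨u, v, r, s, rfl, h1, h2⟩
    obtain ⟨c, hc⟩ := Ideal.mem_span_singleton'.1 hw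
    exact hx ⟨u, v, c, r, s, by rw [← hc, mul_comm], h1, h2⟩)
  rw [Set.disjoint_left] at hd
  -- Taking the other factor to be `1` shows that `S` contains both classes `1 + (a)` and `1 + (b)`.
  obtain ⟨v, hv, s, h⟩ := hcon P hP (hxP (Ideal.mem_span_singleton_self x))
    (fun u hu r h => hd hu ⟨u, 1, r, 0, by simp, h, by simp⟩)
  exact hd hv ⟨1, v, 0, s, by simp, by simp, h⟩

theorem existsUnique_isMaximal_of_splits
    (h : ∀ x a b : R, x ≠ 0 → a + b = 1 → Splits x a b) (p : Ideal R) (hp : p.IsPrime)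
    (hp0 : p ≠ ⊥) : ∃! m : Ideal R, m.IsMaximal ∧ p ≤ m := by
  obtain ⟨m, hm, hpm⟩ := Ideal.exists_le_maximal p hp.ne_top
  refine ⟨m, ⟨hm, hpm⟩, ?_⟩
  rintro m' ⟨hm', hpm'⟩
  by_contra hne
  obtain ⟨x, hxp, hx0⟩ := Submodule.exists_mem_ne_zero_of_ne_bot hp0
  have htop : m ⊔ m' = ⊤ := hm.coprime_of_ne hm' (Ne.symm hne)
  obtain ⟨a, ha, b, hb, hab⟩ := Submodule.mem_sup.1 ((Ideal.eq_top_iff_one _).1 htop)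
  obtain ⟨u, v, c, r, s, h1, h2, h3⟩ := h x a b hx0 hab
  have huv : u * v ∈ p := h1 ▸ p.mul_mem_right c hxp
  rcases hp.mem_or_mem huv with hu | hv
  · exact hm.ne_top ((Ideal.eq_top_iff_one _).2
      (h2 ▸ m.add_mem (hpm hu) (m.mul_mem_right r ha)))
  · exact hm'.ne_top ((Ideal.eq_top_iff_one _).2
      (h3 ▸ m'.add_mem (hpm' hv) (m'.mul_mem_right s hb)))

/-- If `P` were maximal and `a ∉ P`, then `P + (a)` would be the whole ring, giving `u + a * r = 1`
with `u ∈ P`. So `a ∈ P`, likewise `b ∈ P`, and `1 = a + b ∈ P`. -/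
theorem not_isMaximal_of_forall_ne {P : Ideal R} {a b : R} (hab : a + b = 1)
    (ha : ∀ u ∈ P, ∀ r, u + a * r ≠ 1) (hb : ∀ v ∈ P, ∀ s, v + b * s ≠ 1) :
    ¬ P.IsMaximal := by
  intro hP
  have key : ∀ c, (∀ u ∈ P, ∀ r, u + c * r ≠ 1) → c ∈ P := by
    intro c hc
    by_contra hcP
    obtain ⟨y, hy, i, hi, h⟩ := Submodule.mem_sup.1
      ((Ideal.eq_top_iff_one _).1 ((Ideal.isMaximal_def.1 hP).2 (P ⊔ Ideal.span {c})
        (lt_of_le_of_ne le_sup_left fun h => hcP (h ▸ Ideal.mem_sup_right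
          (Ideal.mem_span_singleton_self c)))))
    obtain ⟨r, rfl⟩ := Ideal.mem_span_singleton'.1 hi
    exact hc y hy r (by rw [mul_comm c, h])
  exact hP.ne_top ((Ideal.eq_top_iff_one _).2 (hab ▸ P.add_mem (key a ha) (key b hb)))

theorem splits_of_isDedekindDomain {A : Type*} [CommRing A] [IsDedekindDomain A] {x a b : A}
    (hx : x ≠ 0) (hab : a + b = 1) : Splits x a b := by
  refine (splits_or_exists_prime x a b).resolve_right ?_
  rintro ⟨P, hP, hxP, ha, hb⟩
  exact not_isMaximal_of_forall_ne hab ha hb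
    (hP.isMaximal fun h => hx (by simpa [h] using hxP))

theorem Ultraproduct.splits {ι : Type*} (U : Ultrafilter ι) (A : ι → Type*)
    [∀ i, CommRing (A i)] [∀ i, IsDedekindDomain (A i)] (x a b : Ultraproduct U A)
    (hx : x ≠ 0) (hab : a + b = 1) : Splits x a b := by
  obtain ⟨x, rfl⟩ := Ideal.Quotient.mk_surjective x
  obtain ⟨a, rfl⟩ := Ideal.Quotient.mk_surjective a
  -- With this representative of `b`, the relation `a + b = 1` holds in every component, not just in
  -- almost every one.
  obtain rfl : b = Ideal.Quotient.mk (ultraIdeal U A) (1 - a) := by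
    rw [map_sub, map_one]; linear_combination hab
  have hx' : ∀ᶠ i in (U : Filter ι), x i ≠ 0 := by
    rw [Ultrafilter.eventually_not]
    exact fun h => hx (Ideal.Quotient.eq_zero_iff_mem.2 h)
  -- Where `x i = 0` the product equation is dropped, so that witnesses exist at every index; only
  -- this equation then needs the ultrafilter.
  have key : ∀ i, ∃ u v c r s : A i, (x i ≠ 0 → u * v = x i * c) ∧ u + a i * r = 1 ∧
      v + (1 - a i) * s = 1 := by
    intro i
    by_cases h : x i = 0
    · exact ⟨1, 1, 0, 0, 0, fun h' => absurd h h', by simp, by simp⟩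
    · obtain ⟨u, v, c, r, s, h1, h2⟩ :=
        splits_of_isDedekindDomain h (add_sub_cancel (a i) 1)
      exact ⟨u, v, c, r, s, fun _ => h1, h2⟩
  choose u v c r s h1 h2 h3 using key
  let q := Ideal.Quotient.mk (ultraIdeal U A)
  refine ⟨q u, q v, q c, q r, q s, ?_, ?_, ?_⟩
  · rw [← map_mul, ← map_mul, Ideal.Quotient.eq]
    filter_upwards [hx'] with i hi
    simp [h1 i hi]
  · rw [← map_mul, ← map_add, ← map_one q]
    exact congrArg q (funext h2)
  · rw [← map_mul, ← map_add, ← map_one q]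
    exact congrArg q (funext h3)

end Algebra

/-! ## Rings presented by relations -/

section Relations

variable {T : Type*}

/-- The ternary relation `o` is the graph of a commutative, associative operation with a neutral
element on the elements satisfying `D`. -/
def IsCommMonoidRel (D : T → Prop) (o : T → T → T → Prop) : Prop :=
  (∀ x, D x → ∀ y, D y → ∃ z, D z ∧ o x y z) ∧
  (∀ x, D x → ∀ y, D y → ∀ z, D z → ∀ w, D w → o x y z → o x y w → z = w) ∧
  (∀ x, D x → ∀ y, D y → ∀ z, D z → o x y z → o y x z) ∧
  (∀ x, D x → ∀ y, D y → ∀ z, D z → ∀ u, D u → ∀ v, D v → ∀ w, D w →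
    o x y u → o u z v → o y z w → o x w v) ∧
  (∃ e, D e ∧ ∀ x, D x → o e x x)

/-- `A` and `M` are the graphs of the operations of a commutative ring on the elements
satisfying `D`. -/
def IsCommRingRel (D : T → Prop) (A M : T → T → T → Prop) : Prop :=
  IsCommMonoidRel D A ∧ IsCommMonoidRel D M ∧
  (∀ x, D x → ∃ y, D y ∧ ∀ z, D z → ∀ w, D w → A y x w → A w z z) ∧
  (∀ x, D x → ∀ y, D y → ∀ z, D z → ∀ u, D u → ∀ v, D v → ∀ w, D w → ∀ t, D t →
    A y z u → M x u t → M x y v → M x z w → A v w t)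

/-- `Splits x a b` for the ring with graphs `A` and `M` and identity element `e`. -/
def SplitsRel (D : T → Prop) (A M : T → T → T → Prop) (e a b x : T) : Prop :=
  ∃ u, D u ∧ ∃ v, D v ∧ ∃ c, D c ∧ ∃ r, D r ∧ ∃ s, D s ∧ ∃ w, D w ∧ ∃ r', D r' ∧ ∃ s', D s' ∧
    M u v w ∧ M x c w ∧ M a r r' ∧ A u r' e ∧ M b s s' ∧ A v s' e

/-- `P` is a prime ideal containing `x` and no `u` with `u ≡ 1` modulo `a` or modulo `b`. -/
def IsAvoidingPrimeRel (D : T → Prop) (A M : T → T → T → Prop) (e a b x : T) (P : T → Prop) :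
    Prop :=
  (∀ y, P y → D y) ∧ ¬ P e ∧ P x ∧
  (∀ y, P y → ∀ z, P z → ∀ w, D w → A y z w → P w) ∧
  (∀ y, P y → ∀ z, D z → ∀ w, D w → M y z w → P w) ∧
  (∀ y, D y → ∀ z, D z → ∀ w, P w → M y z w → P y ∨ P z) ∧
  (∀ u, P u → ∀ r, D r → ∀ w, D w → M a r w → ¬ A u w e) ∧
  (∀ u, P u → ∀ r, D r → ∀ w, D w → M b r w → ¬ A u w e)

/-- The relations define operations on `{t // D t}` making it a genuine commutative ring with
identity `e`, to which `splits_or_exists_prime` applies. -/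
theorem IsCommRingRel.splitsRel_or {D : T → Prop} {A M : T → T → T → Prop}
    (h : IsCommRingRel D A M) {e a b x : T} (he : D e) (ha : D a) (hb : D b) (hx : D x)
    (he1 : ∀ y, D y → M e y y) :
    SplitsRel D A M e a b x ∨ ∃ P : T → Prop, IsAvoidingPrimeRel D A M e a b x P := by
  obtain ⟨⟨A1, A2, A3, A4, o, ho, A5⟩, ⟨M1, M2, M3, M4, -⟩, N, Dst⟩ := h
  have hA : ∀ x y : {t // D t}, ∃ z : {t // D t}, A x y z := fun x y => by
    obtain ⟨z, hz, h⟩ := A1 x x.2 y y.2; exact ⟨⟨z, hz⟩, h⟩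
  have hM : ∀ x y : {t // D t}, ∃ z : {t // D t}, M x y z := fun x y => by
    obtain ⟨z, hz, h⟩ := M1 x x.2 y y.2; exact ⟨⟨z, hz⟩, h⟩
  have hN : ∀ x : {t // D t}, ∃ y : {t // D t}, ∀ z : {t // D t}, ∀ w : {t // D t},
      A y x w → A w z z := fun x => by
    obtain ⟨y, hy, h⟩ := N x x.2
    exact ⟨⟨y, hy⟩, fun z w => h z z.2 w w.2⟩
  choose add hadd using hA
  choose mul hmul using hM
  choose neg hneg using hN
  have addEq : ∀ x y z : {t // D t}, A x y z → add x y = z := fun x y z hz =>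
    Subtype.ext (A2 x x.2 y y.2 _ (add x y).2 z z.2 (hadd x y) hz)
  have mulEq : ∀ x y z : {t // D t}, M x y z → mul x y = z := fun x y z hz =>
    Subtype.ext (M2 x x.2 y y.2 _ (mul x y).2 z z.2 (hmul x y) hz)
  have addComm : ∀ x y, add x y = add y x := fun x y =>
    addEq _ _ _ (A3 y y.2 x x.2 _ (add y x).2 (hadd y x))
  let _ : Add {t // D t} := ⟨add⟩
  let _ : Mul {t // D t} := ⟨mul⟩
  let _ : Neg {t // D t} := ⟨neg⟩
  let _ : Zero {t // D t} := ⟨⟨o, ho⟩⟩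
  let _ : One {t // D t} := ⟨⟨e, he⟩⟩
  let _ : CommRing {t // D t} := CommRing.ofMinimalAxioms
    (fun x y z => Eq.symm <| addEq _ _ _ (A4 x x.2 y y.2 z z.2 _ (add x y).2 _
      (add (add x y) z).2 _ (add y z).2 (hadd _ _) (hadd _ _) (hadd _ _)))
    (fun x => addEq _ _ _ (A5 x x.2))
    (fun x => (addEq ⟨o, ho⟩ _ _ (A5 _ (add (neg x) x).2)).symm.trans
      ((addComm _ _).trans (addEq _ _ _ (hneg x ⟨o, ho⟩ _ (hadd _ _)))))
    (fun x y z => Eq.symm <| mulEq _ _ _ (M4 x x.2 y y.2 z z.2 _ (mul x y).2 _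
      (mul (mul x y) z).2 _ (mul y z).2 (hmul _ _) (hmul _ _) (hmul _ _)))
    (fun x y => mulEq _ _ _ (M3 y y.2 x x.2 _ (mul y x).2 (hmul y x)))
    (fun x => mulEq _ _ _ (he1 x x.2))
    (fun x y z => Eq.symm <| addEq _ _ _ (Dst x x.2 y y.2 z z.2 _ (add y z).2 _ (mul x y).2 _
      (mul x z).2 _ (mul x (add y z)).2 (hadd _ _) (hmul _ _) (hmul _ _) (hmul _ _)))
  have addEq' : ∀ x y z : {t // D t}, A x y z → x + y = z := addEq
  have mulEq' : ∀ x y z : {t // D t}, M x y z → x * y = z := mulEq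
  have hadd' : ∀ x y z : {t // D t}, x + y = z → A x y z := fun x y z h => h ▸ hadd x y
  have hmul' : ∀ x y z : {t // D t}, x * y = z → M x y z := fun x y z h => h ▸ hmul x y
  have hone : (⟨e, he⟩ : {t // D t}) = 1 := rfl
  rcases splits_or_exists_prime (⟨x, hx⟩ : {t // D t}) ⟨a, ha⟩ ⟨b, hb⟩ with
    ⟨u, v, c, r, s, h1, h2, h3⟩ | ⟨P, hP, hxP, h1, h2⟩
  · exact Or.inl ⟨u, u.2, v, v.2, c, c.2, r, r.2, s, s.2, _, (u * v).2, _,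
      ((⟨a, ha⟩ : {t // D t}) * r).2, _, ((⟨b, hb⟩ : {t // D t}) * s).2,
      hmul' _ _ _ rfl, hmul' ⟨x, hx⟩ c _ h1.symm, hmul' ⟨a, ha⟩ r _ rfl, hadd' _ _ ⟨e, he⟩ h2,
      hmul' ⟨b, hb⟩ s _ rfl, hadd' _ _ ⟨e, he⟩ h3⟩
  · refine Or.inr ⟨fun t => ∃ h : D t, (⟨t, h⟩ : {t // D t}) ∈ P, fun y hy => hy.1, ?_,
      ⟨hx, hxP⟩, ?_, ?_, ?_, ?_, ?_⟩
    · rintro ⟨_, h⟩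
      exact hP.ne_top ((Ideal.eq_top_iff_one _).2 h)
    · rintro y ⟨hy, hyP⟩ z ⟨hz, hzP⟩ w hw h
      exact ⟨hw, addEq' ⟨y, hy⟩ ⟨z, hz⟩ ⟨w, hw⟩ h ▸ P.add_mem hyP hzP⟩
    · rintro y ⟨hy, hyP⟩ z hz w hw h
      exact ⟨hw, mulEq' ⟨y, hy⟩ ⟨z, hz⟩ ⟨w, hw⟩ h ▸ P.mul_mem_right _ hyP⟩
    · rintro y hy z hz w ⟨hw, hwP⟩ h
      rw [← mulEq' ⟨y, hy⟩ ⟨z, hz⟩ ⟨w, hw⟩ h] at hwP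
      exact (hP.mem_or_mem hwP).imp (fun h => ⟨hy, h⟩) fun h => ⟨hz, h⟩
    · rintro u ⟨hu, huP⟩ r hr w hw h h'
      refine h1 _ huP ⟨r, hr⟩ ?_
      rw [mulEq' ⟨a, ha⟩ ⟨r, hr⟩ ⟨w, hw⟩ h, addEq' ⟨u, hu⟩ ⟨w, hw⟩ ⟨e, he⟩ h', hone]
    · rintro u ⟨hu, huP⟩ r hr w hw h h'
      refine h2 _ huP ⟨r, hr⟩ ?_
      rw [mulEq' ⟨b, hb⟩ ⟨r, hr⟩ ⟨w, hw⟩ h, addEq' ⟨u, hu⟩ ⟨w, hw⟩ ⟨e, he⟩ h', hone]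

end Relations

end Nonstandard

namespace Nonstandard

/-! ## The superstructure -/

section Superstructure

variable {S x y z : ZFSet.{u}}

theorem level_subset_succ (S : ZFSet.{u}) (n : ℕ) : level S n ⊆ level S (n + 1) := by
  intro x hx
  simp [level, hx]

theorem level_mono (S : ZFSet.{u}) : Monotone (level S) :=
  monotone_nat_of_le_succ fun n => level_subset_succ S n

theorem mem_level_succ_of_subset {n : ℕ} (h : x ⊆ level S n) : x ∈ level S (n + 1) := by
  simp [level, h]

/-- Apart from atoms the levels are transitive: a non-atom enters some level as a subset of an
earlier one. -/
theorem subset_level_of_mem {n : ℕ} (hx : x ∈ level S n) (hxS : x ∉ S) : x ⊆ level S n := by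
  induction n with
  | zero => exact absurd hx hxS
  | succ n ih =>
    rcases ZFSet.mem_union.1 hx with h | h
    · exact fun y hy => level_subset_succ S n (ih h hy)
    · exact fun y hy => level_subset_succ S n (ZFSet.mem_powerset.1 h hy)

theorem level_mem_superstructure (S : ZFSet.{u}) (n : ℕ) : level S n ∈ superstructure S :=
  ⟨n + 1, mem_level_succ_of_subset fun _ h => h⟩

theorem mem_superstructure_of_mem (hx : x ∈ superstructure S) (hxS : x ∉ S) (hy : y ∈ x) :
    y ∈ superstructure S := by
  obtain ⟨n, hn⟩ := hx
  exact ⟨n, subset_level_of_mem hn hxS hy⟩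

/-- One element inside the superstructure certifies that a set is not an atom, hence that all its
elements are visible to bounded quantifiers. -/
theorem IsBaseSet.notMem (hS : IsBaseSet S) (hy : y ∈ superstructure S) (hyx : y ∈ x) : x ∉ S :=
  fun h => (hS x h).2 y hyx hy

theorem IsBaseSet.mem_superstructure (hS : IsBaseSet S) (hx : x ∈ superstructure S)
    (hy : y ∈ superstructure S) (hyx : y ∈ x) (hz : z ∈ x) : z ∈ superstructure S :=
  mem_superstructure_of_mem hx (hS.notMem hy hyx) hz

theorem insert_pair_mem_superstructure (hx : x ∈ superstructure S) (hy : y ∈ superstructure S) :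
    ({x, y} : ZFSet.{u}) ∈ superstructure S := by
  obtain ⟨m, hm⟩ := hx
  obtain ⟨n, hn⟩ := hy
  refine ⟨max m n + 1, mem_level_succ_of_subset fun w hw => ?_⟩
  rcases ZFSet.mem_pair.1 hw with rfl | rfl
  · exact level_mono S (le_max_left _ _) hm
  · exact level_mono S (le_max_right _ _) hn

theorem singleton_mem_superstructure (hx : x ∈ superstructure S) :
    ({x} : ZFSet.{u}) ∈ superstructure S := by
  rw [← ZFSet.pair_eq_singleton]
  exact insert_pair_mem_superstructure hx hx

theorem pair_mem_superstructure (hx : x ∈ superstructure S) (hy : y ∈ superstructure S) :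
    ZFSet.pair x y ∈ superstructure S :=
  insert_pair_mem_superstructure (singleton_mem_superstructure hx)
    (insert_pair_mem_superstructure hx hy)

end Superstructure

/-! ## Bounded formulas -/

namespace BoundedFormula

variable {S : ZFSet.{u}}

/-- Truth of a bounded formula under an assignment with values in the superstructure. -/
def Holds (S : ZFSet.{u}) (φ : BoundedFormula) (v : ℕ → superstructure S) : Prop :=
  φ.Realize S fun k => v k

variable {v : ℕ → superstructure S}

@[simp] theorem holds_eq {i j : ℕ} : (eq i j).Holds S v ↔ v i = v j := Subtype.ext_iff.symm

@[simp] theorem holds_mem {i j : ℕ} : (mem i j).Holds S v ↔ (v i).1 ∈ (v j).1 := Iff.rfl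

@[simp] theorem holds_not {φ : BoundedFormula} : φ.not.Holds S v ↔ ¬ φ.Holds S v := Iff.rfl

@[simp] theorem holds_and {φ ψ : BoundedFormula} :
    (φ.and ψ).Holds S v ↔ φ.Holds S v ∧ ψ.Holds S v := Iff.rfl

@[simp] theorem holds_all {k i : ℕ} {φ : BoundedFormula} : (all k i φ).Holds S v ↔
    ∀ x : superstructure S, x.1 ∈ (v i).1 → φ.Holds S (Function.update v k x) := by
  have key : ∀ x : superstructure S, Function.update (fun k => (v k).1) k x.1 =
      fun j => (Function.update v k x j).1 := fun x => by
    funext j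
    by_cases h : j = k
    · subst h; simp
    · simp [h]
  simp only [Holds, Realize, Subtype.forall, ← key]

/-- Implication. -/
def imp (φ ψ : BoundedFormula) : BoundedFormula := (φ.and ψ.not).not

/-- Disjunction. -/
def or (φ ψ : BoundedFormula) : BoundedFormula := (φ.not.and ψ.not).not

/-- Bounded existential quantification. -/
def ex (k i : ℕ) (φ : BoundedFormula) : BoundedFormula := (all k i φ.not).not

@[simp] theorem holds_imp {φ ψ : BoundedFormula} :
    (φ.imp ψ).Holds S v ↔ (φ.Holds S v → ψ.Holds S v) := by simp [imp]

@[simp] theorem holds_or {φ ψ : BoundedFormula} :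
    (φ.or ψ).Holds S v ↔ φ.Holds S v ∨ ψ.Holds S v := by simp [or]; tauto

@[simp] theorem holds_ex {k i : ℕ} {φ : BoundedFormula} : (ex k i φ).Holds S v ↔
    ∃ x : superstructure S, x.1 ∈ (v i).1 ∧ φ.Holds S (Function.update v k x) := by simp [ex]

/-- `v s = {v x}`, with bound variable `k`. -/
def isSingleton (k s x : ℕ) : BoundedFormula := (mem x s).and (all k s (eq k x))

/-- `v s = {v x, v y}`, with bound variable `k`. -/
def isPairSet (k s x y : ℕ) : BoundedFormula :=
  (mem x s).and ((mem y s).and (all k s ((eq k x).or (eq k y))))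

/-- `v z = (v x, v y)`, with bound variables `k` and `k + 1`. -/
def isPair (k z x y : ℕ) : BoundedFormula :=
  (ex k z (isSingleton (k + 1) k x)).and ((ex k z (isPairSet (k + 1) k x y)).and
    (all k z ((isSingleton (k + 1) k x).or (isPairSet (k + 1) k x y))))

/-- `((v x, v y), v z) ∈ v A`, with bound variables `40, …, 44`. -/
def op (A x y z : ℕ) : BoundedFormula :=
  ex 40 A (ex 41 40 (ex 42 41 ((isPair 43 42 x y).and (isPair 43 40 42 z))))

/-- Since `v x` is a visible element of `v s`, the set `v s` is not an atom, so the quantifier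
reaches all its elements and extensionality applies. -/
theorem holds_isSingleton (hS : IsBaseSet S) {k s x : ℕ} (hx : x < k) :
    (isSingleton k s x).Holds S v ↔ (v s).1 = {(v x).1} := by
  simp only [isSingleton, holds_and, holds_mem, holds_all, holds_eq, Function.update_self,
    Function.update_of_ne hx.ne]
  constructor
  · rintro ⟨h1, h2⟩
    ext w
    rw [ZFSet.mem_singleton]
    refine ⟨fun hw => ?_, fun hw => hw ▸ h1⟩
    exact congrArg Subtype.val (h2 ⟨w, hS.mem_superstructure (v s).2 (v x).2 h1 hw⟩ hw)
  · intro h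
    simp [h, Subtype.ext_iff]

theorem holds_isPairSet (hS : IsBaseSet S) {k s x y : ℕ} (hx : x < k)
    (hy : y < k) : (isPairSet k s x y).Holds S v ↔ (v s).1 = {(v x).1, (v y).1} := by
  simp only [isPairSet, holds_and, holds_mem, holds_all, holds_or, holds_eq,
    Function.update_self, Function.update_of_ne hx.ne, Function.update_of_ne hy.ne]
  constructor
  · rintro ⟨h1, h2, h3⟩
    ext w
    rw [ZFSet.mem_pair]
    refine ⟨fun hw => ?_, fun hw => hw.elim (fun h => h ▸ h1) fun h => h ▸ h2⟩
    exact (h3 ⟨w, hS.mem_superstructure (v s).2 (v x).2 h1 hw⟩ hw).imp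
      (congrArg Subtype.val) (congrArg Subtype.val)
  · intro h
    simp [h, Subtype.ext_iff]

theorem holds_isPair (hS : IsBaseSet S) {k z x y : ℕ} (hx : x < k) (hy : y < k) :
    (isPair k z x y).Holds S v ↔ (v z).1 = ZFSet.pair (v x).1 (v y).1 := by
  simp only [isPair, holds_and, holds_all, holds_ex, holds_or,
    holds_isSingleton hS (hx.trans (Nat.lt_succ_self k)),
    holds_isPairSet hS (hx.trans (Nat.lt_succ_self k))
      (hy.trans (Nat.lt_succ_self k)), Function.update_self, Function.update_of_ne hx.ne,
    Function.update_of_ne hy.ne]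
  constructor
  · rintro ⟨⟨s, hs, hs'⟩, ⟨t, ht, ht'⟩, h⟩
    ext w
    rw [ZFSet.pair, ZFSet.mem_pair]
    refine ⟨fun hw => h ⟨w, hS.mem_superstructure (v z).2 s.2 hs hw⟩ hw, ?_⟩
    rintro (rfl | rfl)
    · exact hs' ▸ hs
    · exact ht' ▸ ht
  · intro h
    rw [h, ZFSet.pair]
    refine ⟨⟨⟨_, singleton_mem_superstructure (v x).2⟩, by simp, rfl⟩,
      ⟨⟨_, insert_pair_mem_superstructure (v x).2 (v y).2⟩, by simp, rfl⟩, fun w hw => ?_⟩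
    exact ZFSet.mem_pair.1 hw

end BoundedFormula

/-- `((x, y), z) ∈ A`. -/
def opRel {S : ZFSet.{u}} (A : ZFSet.{u}) (x y z : superstructure S) : Prop :=
  ZFSet.pair (ZFSet.pair x y) z ∈ A

/-! ### Bounded formulas for rings, splittings and avoiding primes -/

namespace BoundedFormula

variable {S : ZFSet.{u}} {v : ℕ → superstructure S}

/-- The inner pair `p = (x, y)` is reached by bounded quantifiers along `A ∋ w ∋ s ∋ p`, where `w =
(p, z)` and `s` can be taken to be `{p}`. -/
theorem holds_op (hS : IsBaseSet S) {A x y z : ℕ} (hx : x < 40) (hy : y < 40)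
    (hz : z < 40) : (op A x y z).Holds S v ↔ opRel (v A).1 (v x) (v y) (v z) := by
  have ne : ∀ {i k : ℕ}, i < 40 → 40 ≤ k → i ≠ k := fun h h' => by omega
  have lt : ∀ {i : ℕ}, i < 40 → i < 43 := fun h => by omega
  simp only [op, holds_ex, holds_and, holds_isPair hS (lt hx) (lt hy),
    holds_isPair hS (show 42 < 43 by norm_num) (lt hz),
    Function.update_self, Function.update_of_ne (ne hx le_rfl),
    Function.update_of_ne (ne hx (show 40 ≤ 41 by norm_num)),
    Function.update_of_ne (ne hx (show 40 ≤ 42 by norm_num)),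
    Function.update_of_ne (ne hy le_rfl),
    Function.update_of_ne (ne hy (show 40 ≤ 41 by norm_num)),
    Function.update_of_ne (ne hy (show 40 ≤ 42 by norm_num)),
    Function.update_of_ne (ne hz le_rfl),
    Function.update_of_ne (ne hz (show 40 ≤ 41 by norm_num)),
    Function.update_of_ne (ne hz (show 40 ≤ 42 by norm_num)),
    Function.update_of_ne (show 40 ≠ 41 by norm_num),
    Function.update_of_ne (show 40 ≠ 42 by norm_num), opRel]
  constructor
  · rintro ⟨w, hw, s, hs, p, hp, h1, h2⟩
    rwa [h2, h1] at hw
  · intro h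
    have hp := pair_mem_superstructure (v x).2 (v y).2
    exact ⟨⟨_, pair_mem_superstructure hp (v z).2⟩, h, ⟨_, singleton_mem_superstructure hp⟩,
      by simp [ZFSet.pair], ⟨_, hp⟩, by simp, rfl, rfl⟩

/-- The operation with graph `v o` is a commutative monoid on `v 4`. -/
def commMonoid (o : ℕ) : BoundedFormula :=
  (all 12 4 (all 13 4 (ex 14 4 (op o 12 13 14)))).and
  ((all 12 4 (all 13 4 (all 14 4 (all 15 4
    ((op o 12 13 14).imp ((op o 12 13 15).imp (eq 14 15))))))).and
  ((all 12 4 (all 13 4 (all 14 4 ((op o 12 13 14).imp (op o 13 12 14))))).and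
  ((all 12 4 (all 13 4 (all 14 4 (all 15 4 (all 16 4 (all 17 4 ((op o 12 13 15).imp
    ((op o 15 14 16).imp ((op o 13 14 17).imp (op o 12 17 16)))))))))).and
  (ex 12 4 (all 13 4 (op o 12 13 13))))))

/-- `v 5` and `v 6` are the graphs of the operations of a commutative ring on `v 4`. -/
def commRing : BoundedFormula :=
  (commMonoid 5).and ((commMonoid 6).and
  ((all 12 4 (ex 13 4 (all 14 4 (all 15 4 ((op 5 13 12 15).imp (op 5 15 14 14)))))).and
  (all 12 4 (all 13 4 (all 14 4 (all 15 4 (all 16 4 (all 17 4 (all 18 4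
    ((op 5 13 14 15).imp ((op 6 12 15 18).imp ((op 6 12 13 16).imp ((op 6 12 14 17).imp
      (op 5 16 17 18))))))))))))))

/-- `SplitsRel` for the ring `v 4`, the identity element `v 7` and `v 8`, `v 9`, `v 10`. -/
def splits : BoundedFormula :=
  ex 12 4 (ex 13 4 (ex 14 4 (ex 15 4 (ex 16 4 (ex 17 4 (ex 18 4 (ex 19 4
    ((op 6 12 13 17).and ((op 6 10 14 17).and ((op 6 8 15 18).and ((op 5 12 18 7).and
    ((op 6 9 16 19).and (op 5 13 19 7)))))))))))))

/-- `IsAvoidingPrimeRel` for `v 11`. -/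
def avoidingPrime : BoundedFormula :=
  (all 12 11 (mem 12 4)).and ((mem 7 11).not.and ((mem 10 11).and
  ((all 12 11 (all 13 11 (all 14 4 ((op 5 12 13 14).imp (mem 14 11))))).and
  ((all 12 11 (all 13 4 (all 14 4 ((op 6 12 13 14).imp (mem 14 11))))).and
  ((all 12 4 (all 13 4 (all 14 11 ((op 6 12 13 14).imp ((mem 12 11).or (mem 13 11)))))).and
  ((all 12 11 (all 13 4 (all 14 4 ((op 6 8 13 14).imp (op 5 12 14 7).not)))).and
  (all 12 11 (all 13 4 (all 14 4 ((op 6 9 13 14).imp (op 5 12 14 7).not))))))))))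

/-- All rings with underlying set in `v 0` and graphs of the operations in `v 1` and `v 2`
have splittings or avoiding prime ideals belonging to `v 3`. -/
def dichotomy : BoundedFormula :=
  all 4 0 (all 5 1 (all 6 2 (commRing.imp (all 7 4 ((all 12 4 (op 6 7 12 12)).imp
    (all 8 4 (all 9 4 (all 10 4 (splits.or (ex 11 3 avoidingPrime))))))))))

/-- Indices `0` to `3` hold the bounding sets, `4` to `11` the ring, its graphs, `e`, `a`, `b`, `x`
and the prime; `12` to `19` are bound elements. Hence `o < 12` prevents capture. -/
theorem holds_commMonoid (hS : IsBaseSet S) {o : ℕ} (ho : o < 12) :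
    (commMonoid o).Holds S v ↔
      IsCommMonoidRel (fun x : superstructure S => x.1 ∈ (v 4).1) (opRel (v o).1) := by
  have ne : ∀ k, 12 ≤ k → o ≠ k := fun k h => by omega
  simp [commMonoid, IsCommMonoidRel, holds_op hS, Function.update_of_ne (ne 12 (by norm_num)),
    Function.update_of_ne (ne 13 (by norm_num)), Function.update_of_ne (ne 14 (by norm_num)),
    Function.update_of_ne (ne 15 (by norm_num)), Function.update_of_ne (ne 16 (by norm_num)),
    Function.update_of_ne (ne 17 (by norm_num)), -Subtype.forall, -Subtype.exists]

theorem holds_commRing (hS : IsBaseSet S) : commRing.Holds S v ↔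
    IsCommRingRel (fun x : superstructure S => x.1 ∈ (v 4).1) (opRel (v 5).1) (opRel (v 6).1) := by
  simp [commRing, IsCommRingRel, holds_commMonoid hS, holds_op hS, -Subtype.forall,
    -Subtype.exists]

theorem holds_splits (hS : IsBaseSet S) : splits.Holds S v ↔
    SplitsRel (fun x => x.1 ∈ (v 4).1) (opRel (v 5).1) (opRel (v 6).1)
      (v 7) (v 8) (v 9) (v 10) := by
  simp [splits, SplitsRel, holds_op hS, -Subtype.forall, -Subtype.exists]

theorem holds_avoidingPrime (hS : IsBaseSet S) : avoidingPrime.Holds S v ↔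
    IsAvoidingPrimeRel (fun x => x.1 ∈ (v 4).1) (opRel (v 5).1) (opRel (v 6).1)
      (v 7) (v 8) (v 9) (v 10) (fun x => x.1 ∈ (v 11).1) := by
  simp [avoidingPrime, IsAvoidingPrimeRel, holds_op hS, -Subtype.forall, -Subtype.exists]

theorem holds_dichotomy (hS : IsBaseSet S) : dichotomy.Holds S v ↔
    ∀ B : superstructure S, B.1 ∈ (v 0).1 → ∀ A : superstructure S, A.1 ∈ (v 1).1 →
    ∀ M : superstructure S, M.1 ∈ (v 2).1 →
      IsCommRingRel (fun x : superstructure S => x.1 ∈ B.1) (opRel A.1) (opRel M.1) →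
      ∀ e : superstructure S, e.1 ∈ B.1 →
      (∀ y : superstructure S, y.1 ∈ B.1 → opRel M.1 e y y) →
      ∀ a : superstructure S, a.1 ∈ B.1 → ∀ b : superstructure S, b.1 ∈ B.1 →
      ∀ x : superstructure S, x.1 ∈ B.1 →
        SplitsRel (fun x => x.1 ∈ B.1) (opRel A.1) (opRel M.1) e a b x ∨
        ∃ P : superstructure S, P.1 ∈ (v 3).1 ∧ IsAvoidingPrimeRel (fun x => x.1 ∈ B.1)
          (opRel A.1) (opRel M.1) e a b x (fun x => x.1 ∈ P.1) := by
  simp [dichotomy, holds_op hS, holds_commRing hS, holds_splits hS, holds_avoidingPrime hS,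
    -Subtype.forall, -Subtype.exists]

end BoundedFormula

end Nonstandard

/-! ### The dichotomy in the standard superstructure, and graphs of ring operations -/

namespace Nonstandard

section Standard

variable {S : ZFSet.{u}}

/-- From `B ∈ X ∈ level S n` it follows that `B ⊆ level S n`, so every subset of `B` lies in `level
S (n + 1)`. This bound does not depend on `B`, which makes the existence of the prime a bounded
statement. -/
theorem exists_avoidingPrime_mem_level (hS : IsBaseSet S) {X : ZFSet.{u}} {n : ℕ}
    (hX : X ∈ level S n) {B A M : superstructure S} (hB : B.1 ∈ X)
    (h : IsCommRingRel (fun x : superstructure S => x.1 ∈ B.1) (opRel A.1) (opRel M.1))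
    {e a b x : superstructure S} (he : e.1 ∈ B.1) (ha : a.1 ∈ B.1) (hb : b.1 ∈ B.1)
    (hx : x.1 ∈ B.1) (he1 : ∀ y : superstructure S, y.1 ∈ B.1 → opRel M.1 e y y) :
    SplitsRel (fun x : superstructure S => x.1 ∈ B.1) (opRel A.1) (opRel M.1) e a b x ∨
      ∃ P : superstructure S, P.1 ∈ level S (n + 1) ∧
        IsAvoidingPrimeRel (fun x => x.1 ∈ B.1) (opRel A.1) (opRel M.1) e a b x
          (fun x => x.1 ∈ P.1) := by
  refine (h.splitsRel_or he ha hb hx he1).imp_right ?_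
  rintro ⟨P, hP⟩
  have hBn : B.1 ⊆ level S n :=
    subset_level_of_mem (subset_level_of_mem hX (hS.notMem B.2 hB) hB) (hS.notMem e.2 he)
  let Q : ZFSet.{u} := B.1.sep fun y => ∃ h : y ∈ superstructure S, P ⟨y, h⟩
  have hQ : Q ∈ level S (n + 1) :=
    mem_level_succ_of_subset fun y hy => hBn (ZFSet.mem_sep.1 hy).1
  refine ⟨⟨Q, n + 1, hQ⟩, hQ, ?_⟩
  have hPQ : (fun y : superstructure S => y.1 ∈ Q) = P := by
    funext y
    exact propext (ZFSet.mem_sep.trans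
      ⟨fun h => h.2.2, fun h => ⟨hP.1 y h, y.2, h⟩⟩)
  rwa [hPQ]

end Standard

theorem pair_mem_graph₂ {B : ZFSet.{u}} (f : B → B → B) (x y z : B) :
    ZFSet.pair (ZFSet.pair x.1 y.1) z.1 ∈ graph₂ f ↔ f x y = z := by
  rw [graph₂, ZFSet.mem_sep, ZFSet.pair_mem_prod, ZFSet.pair_mem_prod]
  constructor
  · rintro ⟨-, x', y', h⟩
    obtain ⟨h1, h3⟩ := ZFSet.pair_inj.1 h
    obtain ⟨h1, h2⟩ := ZFSet.pair_inj.1 h1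
    rw [Subtype.ext h1, Subtype.ext h2, Subtype.ext h3]
  · rintro rfl
    exact ⟨⟨⟨x.2, y.2⟩, (f x y).2⟩, x, y, rfl⟩

section Graphs

variable {S B : ZFSet.{u}}

theorem opRel_graph₂ (f : B → B → B) {x y z : superstructure S} (hx : x.1 ∈ B) (hy : y.1 ∈ B)
    (hz : z.1 ∈ B) : opRel (graph₂ f) x y z ↔ f ⟨x, hx⟩ ⟨y, hy⟩ = ⟨z, hz⟩ :=
  pair_mem_graph₂ f ⟨x, hx⟩ ⟨y, hy⟩ ⟨z, hz⟩

theorem isCommMonoidRel_graph₂ (hB : ∀ y ∈ B, y ∈ superstructure S) (f : B → B → B)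
    (assoc : ∀ x y z, f (f x y) z = f x (f y z)) (comm : ∀ x y, f x y = f y x) (e : B)
    (he : ∀ x, f e x = x) :
    IsCommMonoidRel (fun x : superstructure S => x.1 ∈ B) (opRel (graph₂ f)) := by
  refine ⟨fun x hx y hy => ?_, fun x hx y hy z hz w hw h1 h2 => ?_, fun x hx y hy z hz h => ?_,
    fun x hx y hy z hz u hu v hv w hw h1 h2 h3 => ?_, ?_⟩
  · exact ⟨⟨_, hB _ (f ⟨x, hx⟩ ⟨y, hy⟩).2⟩, (f ⟨x, hx⟩ ⟨y, hy⟩).2,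
      (opRel_graph₂ f hx hy _).2 rfl⟩
  · rw [opRel_graph₂ f hx hy hz] at h1
    rw [opRel_graph₂ f hx hy hw, h1] at h2
    exact Subtype.ext (Subtype.mk.inj h2)
  · rw [opRel_graph₂ f hx hy hz] at h
    rw [opRel_graph₂ f hy hx hz, comm, h]
  · rw [opRel_graph₂ f hx hy hu] at h1
    rw [opRel_graph₂ f hu hz hv] at h2
    rw [opRel_graph₂ f hy hz hw] at h3
    rw [opRel_graph₂ f hx hw hv, ← h3, ← assoc, h1, h2]
  · exact ⟨⟨e, hB e e.2⟩, e.2, fun x hx => (opRel_graph₂ f e.2 hx hx).2 (he _)⟩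

theorem isCommRingRel_graph₂ [CommRing B] (hB : ∀ y ∈ B, y ∈ superstructure S) :
    IsCommRingRel (fun x : superstructure S => x.1 ∈ B)
      (opRel (graph₂ fun x y : B => x + y)) (opRel (graph₂ fun x y : B => x * y)) := by
  refine ⟨isCommMonoidRel_graph₂ hB _ add_assoc add_comm 0 zero_add,
    isCommMonoidRel_graph₂ hB _ mul_assoc mul_comm 1 one_mul, fun x hx => ?_,
    fun x hx y hy z hz u hu v hv w hw t ht h1 h2 h3 h4 => ?_⟩
  · refine ⟨⟨_, hB _ (-⟨x, hx⟩ : B).2⟩, (-⟨x, hx⟩ : B).2, fun z hz w hw h => ?_⟩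
    rw [opRel_graph₂ _ (-⟨x, hx⟩ : B).2 hx hw] at h
    rw [opRel_graph₂ _ hw hz hz, ← h]
    exact (congrArg (· + (⟨z, hz⟩ : B)) (neg_add_cancel (⟨x, hx⟩ : B))).trans (zero_add _)
  · rw [opRel_graph₂ _ hy hz hu] at h1
    rw [opRel_graph₂ _ hx hu ht] at h2
    rw [opRel_graph₂ _ hx hy hv] at h3
    rw [opRel_graph₂ _ hx hz hw] at h4
    rw [opRel_graph₂ _ hv hw ht, ← h2, ← h3, ← h4, ← h1]
    exact (mul_add _ _ _).symm

variable [CommRing B] {e a b x : superstructure S}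

theorem SplitsRel.splits {ha : a.1 ∈ B} {hb : b.1 ∈ B} {hx : x.1 ∈ B} {he : e.1 ∈ B}
    (he1 : (⟨e, he⟩ : B) = 1)
    (h : SplitsRel (fun x : superstructure S => x.1 ∈ B) (opRel (graph₂ fun x y : B => x + y))
      (opRel (graph₂ fun x y : B => x * y)) e a b x) :
    Splits (⟨x, hx⟩ : B) ⟨a, ha⟩ ⟨b, hb⟩ := by
  obtain ⟨u, hu, v, hv, c, hc, r, hr, s, hs, w, hw, r', hr', s', hs', h1, h2, h3, h4, h5, h6⟩ := h
  refine ⟨⟨u, hu⟩, ⟨v, hv⟩, ⟨c, hc⟩, ⟨r, hr⟩, ⟨s, hs⟩, ?_, ?_, ?_⟩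
  · exact ((opRel_graph₂ _ hu hv hw).1 h1).trans ((opRel_graph₂ _ hx hc hw).1 h2).symm
  · rw [← he1, ← (opRel_graph₂ _ hu hr' he).1 h4, ← (opRel_graph₂ _ ha hr hr').1 h3]
  · rw [← he1, ← (opRel_graph₂ _ hv hs' he).1 h6, ← (opRel_graph₂ _ hb hs hs').1 h5]

/-- The ideal has exactly `P` as its underlying set, so internality of `P` passes to it. -/
theorem IsAvoidingPrimeRel.exists_ideal (hB : ∀ y ∈ B, y ∈ superstructure S)
    {ha : a.1 ∈ B} {hb : b.1 ∈ B} {hx : x.1 ∈ B} {he : e.1 ∈ B}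
    (he1 : (⟨e, he⟩ : B) = 1) {P : ZFSet.{u}} (hP : ∀ y ∈ P, y ∈ superstructure S)
    (h : IsAvoidingPrimeRel (fun x : superstructure S => x.1 ∈ B)
      (opRel (graph₂ fun x y : B => x + y)) (opRel (graph₂ fun x y : B => x * y)) e a b x
      (fun x => x.1 ∈ P)) :
    ∃ I : Ideal B, ofSubset B (I : Set B) = P ∧ I.IsPrime ∧ (⟨x, hx⟩ : B) ∈ I ∧
      (∀ u ∈ I, ∀ r, u + ⟨a, ha⟩ * r ≠ 1) ∧ ∀ v ∈ I, ∀ s, v + ⟨b, hb⟩ * s ≠ 1 := by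
  obtain ⟨hPB, heP, hxP, hadd, hmul, hprime, hu, hv⟩ := h
  have smul : ∀ c y : B, y.1 ∈ P → (c * y).1 ∈ P := fun c y hy => by
    refine hmul ⟨y, hP _ hy⟩ hy ⟨c, hB _ c.2⟩ c.2 ⟨_, hB _ (c * y).2⟩ (c * y).2 ?_
    rw [opRel_graph₂ _ y.2 c.2 (c * y).2]
    exact mul_comm y c
  let I : Ideal B :=
    { carrier := {y | y.1 ∈ P}
      add_mem' := fun {y z} hy hz => hadd ⟨y, hP _ hy⟩ hy ⟨z, hP _ hz⟩ hz
        ⟨_, hB _ (y + z).2⟩ (y + z).2 ((opRel_graph₂ _ y.2 z.2 (y + z).2).2 rfl)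
      zero_mem' := by simpa using smul 0 ⟨x, hx⟩ hxP
      smul_mem' := smul }
  refine ⟨I, ?_, ⟨?_, ?_⟩, hxP, ?_, ?_⟩
  · ext y
    exact ZFSet.mem_sep.trans ⟨fun h => h.2.2, fun h => ⟨hPB ⟨y, hP y h⟩ h, hPB ⟨y, hP y h⟩ h, h⟩⟩
  · rw [Ne, Ideal.eq_top_iff_one, ← he1]
    exact heP
  · intro y z hyz
    exact hprime ⟨y, hB _ y.2⟩ y.2 ⟨z, hB _ z.2⟩ z.2 ⟨_, hB _ (y * z).2⟩ hyz
      ((opRel_graph₂ _ y.2 z.2 (y * z).2).2 rfl)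
  · intro u huI r h
    rw [← he1] at h
    exact hu ⟨u, hB _ u.2⟩ huI ⟨r, hB _ r.2⟩ r.2 ⟨_, hB _ (⟨a, ha⟩ * r : B).2⟩
      (⟨a, ha⟩ * r : B).2 ((opRel_graph₂ _ ha r.2 (⟨a, ha⟩ * r : B).2).2 rfl)
      ((opRel_graph₂ _ u.2 (⟨a, ha⟩ * r : B).2 he).2 h)
  · intro u huI r h
    rw [← he1] at h
    exact hv ⟨u, hB _ u.2⟩ huI ⟨r, hB _ r.2⟩ r.2 ⟨_, hB _ (⟨b, hb⟩ * r : B).2⟩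
      (⟨b, hb⟩ * r : B).2 ((opRel_graph₂ _ hb r.2 (⟨b, hb⟩ * r : B).2).2 rfl)
      ((opRel_graph₂ _ u.2 (⟨b, hb⟩ * r : B).2 he).2 h)

end Graphs

end Nonstandard

/-! ### Transfer to internal rings -/

namespace NonstandardEmbedding

open Nonstandard BoundedFormula

variable {E : NonstandardEmbedding.{u}}

theorem IsInternal.subset_superstructure {B : ZFSet.{u}} (h : E.IsInternal B) :
    ∀ y ∈ B, y ∈ superstructure (E.star E.base) :=
  fun _ => mem_superstructure_of_mem h.1 h.2.1

/-- Transfer of the dichotomy between splittings and avoiding prime ideals to internal rings. -/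
theorem IsInternalRing.splits_or_exists_prime {B : ZFSet.{u}} [CommRing B]
    (h : E.IsInternalRing B) (x a b : B) :
    Splits x a b ∨ ∃ I : Ideal B, E.IsInternal (ofSubset B (I : Set B)) ∧ I.IsPrime ∧ x ∈ I ∧
      (∀ u ∈ I, ∀ r, u + a * r ≠ 1) ∧ ∀ v ∈ I, ∀ s, v + b * s ≠ 1 := by
  have hB := h.carrier.subset_superstructure
  obtain ⟨hBs, -, X, ⟨n, hXn⟩, hBX⟩ := h.carrier
  obtain ⟨hAs, -, X₁, hX₁, hAX⟩ := h.add
  obtain ⟨hMs, -, X₂, hX₂, hMX⟩ := h.mul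
  -- `Y` contains every subset of every ring belonging to `X`; after transfer the prime is found in
  -- `*Y` and is therefore internal.
  let Y := level E.base (n + 1)
  have hY : Y ∈ superstructure E.base := level_mem_superstructure _ _
  let v : ℕ → superstructure E.base
    | 0 => ⟨X, n, hXn⟩
    | 1 => ⟨X₁, hX₁⟩
    | 2 => ⟨X₂, hX₂⟩
    | _ => ⟨Y, hY⟩
  have hv : dichotomy.Holds E.base v := by
    rw [holds_dichotomy E.isBaseSet]
    intro B hB A _ M _ hr e he he1 a ha b hb x hx
    exact exists_avoidingPrime_mem_level E.isBaseSet hXn hB hr he ha hb hx he1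
  let w : ℕ → superstructure (E.star E.base) := fun k => ⟨E.star (v k), E.star_mem _ (v k).2⟩
  have hw : dichotomy.Holds (E.star E.base) w :=
    (E.transfer dichotomy (fun k => v k) fun k => (v k).2).1 hv
  rw [holds_dichotomy E.isBaseSet_star] at hw
  have hone : (⟨(1 : B).1, (1 : B).2⟩ : B) = 1 := rfl
  rcases hw ⟨B, hBs⟩ hBX ⟨_, hAs⟩ hAX ⟨_, hMs⟩ hMX (isCommRingRel_graph₂ hB)
    ⟨(1 : B), hB _ (1 : B).2⟩ (1 : B).2
    (fun y hy => (opRel_graph₂ _ (1 : B).2 hy hy).2 (one_mul (⟨y, hy⟩ : B)))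
    ⟨a, hB _ a.2⟩ a.2 ⟨b, hB _ b.2⟩ b.2 ⟨x, hB _ x.2⟩ x.2 with hs | ⟨P, hPY, hP⟩
  · exact Or.inl (hs.splits (ha := a.2) (hb := b.2) (hx := x.2) hone)
  -- `P` is not an atom, since it contains `x`.
  · have hPb := E.isBaseSet_star.notMem (hB _ x.2) hP.2.2.1
    obtain ⟨I, hI, hI'⟩ := hP.exists_ideal hB (ha := a.2) (hb := b.2) (hx := x.2) hone
      fun y => mem_superstructure_of_mem P.2 hPb
    refine Or.inr ⟨I, ?_, hI'⟩
    rw [hI]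
    exact ⟨P.2, hPb, Y, hY, hPY⟩

/-- The other alternative would give an internal prime that is nonzero because it contains `x`,
hence maximal, contradicting `a + b = 1`. -/
theorem IsInternalDedekindRing.splits {B L : ZFSet.{u}} [CommRing B] [Field L] [Algebra B L]
    (h : E.IsInternalDedekindRing B L) (x a b : B) (hx : x ≠ 0) (hab : a + b = 1) :
    Splits x a b := by
  refine (h.isInternalRing.splits_or_exists_prime x a b).resolve_right ?_
  rintro ⟨I, hI, hIp, hxI, ha, hb⟩
  exact not_isMaximal_of_forall_ne hab ha hb
    (h.isMaximal_of_isPrime I hI (fun h => hx (by simpa [h] using hxI)) hIp)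

end NonstandardEmbedding

theorem mainTheorem2 :
    (∀ (E : NonstandardEmbedding.{u}) (B L : ZFSet.{u}) [CommRing B] [Field L] [Algebra B L],
      E.IsInternalDedekindRing B L →
      ∀ p : Ideal B, p.IsPrime → p ≠ ⊥ → ∃! m : Ideal B, m.IsMaximal ∧ p ≤ m) ∧
    (∀ {ι : Type*} (U : Ultrafilter ι) (A : ι → Type*) [∀ i, CommRing (A i)]
      [∀ i, IsDedekindDomain (A i)],
      ∀ p : Ideal (Nonstandard.Ultraproduct U A), p.IsPrime → p ≠ ⊥ →
        ∃! m : Ideal (Nonstandard.Ultraproduct U A), m.IsMaximal ∧ p ≤ m) := by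
  refine ⟨fun E B L _ _ _ h => ?_, fun U A _ _ => ?_⟩
  · exact Nonstandard.existsUnique_isMaximal_of_splits h.splits
  · exact Nonstandard.existsUnique_isMaximal_of_splits (Nonstandard.Ultraproduct.splits U A)
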